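/- **Theorem 3 (Variance of EVO).** Let $\mu,\nu>0$ with $\mu+\nu<1$. For a probability distribution $P$ on $\mathbb{R}$ with CDF $F_P$ write $q^P_\tau=\inf\{x: F_P(x)\ge\tau\}$ for its $\tau$-quantile, and for i.i.d. samples $X_1,\dots,X_N$ from $P$ let $\hat q^{P}_{\tau,N}=\inf\{t:\frac1N\#\{i\le N: X_i\le t\}\ge\tau\}$ be the sample quantile. Let $H$ be a probability distribution on $\mathbb{R}$ (such as a generalized Pareto distribution modelling the tail of a cost) whose CDF $F_H$ is continuous and which near $q^H:=q^H_{\nu/(1-\mu)}$ has a density $f_H$ that is continuous at $q^H$ with $f_H(q^H)>0$. (i) As $N\to\infty$, $$\sqrt N\Big(\hat q^{H}_{\frac{\nu}{1-\mu},N}-q^H\Big)\xrightarrow{d}\mathcal N\Big(0,\ \frac{\nu(1-\mu-\nu)}{(1-\mu)^2f_H^2(q^H)}\Big),$$ that is, the estimator of $q^H$ is asymptotically normal with asymptotic variance $\Omega_N=\dfrac{\nu(1-\mu-\nu)}{N(1-\mu)^2f_H^2(q^H)}$, in the sense that $(\hat q^{H}_{\frac{\nu}{1-\mu},N}-q^H)/\sqrt{\Omega_N}\xrightarrow{d}\mathcal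 N(0,1)$. (ii) Let $C$ be a real random variable (the cost) with quantiles $q_\tau$, such that $P(C\le q_\mu)=\mu$ and such that the conditional distribution of $C-q_\mu$ given $C>q_\mu$ is $H$, and let $f_C$ be a density of $C$ near $q_{\mu+\nu}$ that is continuous at $q_{\mu+\nu}$. Then $q_{\mu+\nu}=q_\mu+q^H$; the relation $f_C(q_\mu+z)=(1-\mu)f_H(z)$ holds at every $z>0$ such that $f_H$ is a density of $H$ near $z$ and continuous at $z$, and $f_C$ is a density of $C$ near $q_\mu+z$ and continuous at $q_\mu+z$; in particular $f_C(q_{\mu+\nu})=(1-\mu)f_H(q^H)$. The sample $(\mu+\nu)$-quantile of i.i.d. copies of $C$ is asymptotically normal around $q_{\mu+\nu}$ with asymptotic variance $$\Omega_{2,N}=\frac{(\mu+\nu)(1-\mu-\nu)}{N f_C^2(q_{\mu+\nu})}$$ (i.e. $\sqrt N$ times its error converges in distribution to $\mathcal N(0,N\Omega_{2,N})$, where $N\Omega_{2,N}$ does not depend on $N$), and $\Omega_N<\Omega_{2,N}$ for every $N\ge1$. -/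

import Mathlib

open MeasureTheory ProbabilityTheory Filter Topology

noncomputable section

/-- The quantile of level `τ` of a probability distribution `P` on the line:
`inf {x | F_P x ≥ τ}`, where `F_P` is the cumulative distribution function. -/
def quantile (P : Measure ℝ) (τ : ℝ) : ℝ :=
  sInf {x : ℝ | τ ≤ cdf P x}

/-- The sample quantile of level `τ` of the first `N` terms of `x`: the quantile of level `τ` of
the empirical distribution function `t ↦ #{i < N | x i ≤ t} / N`. -/
def sampleQuantile (N : ℕ) (x : ℕ → ℝ) (τ : ℝ) : ℝ :=
  sInf {t : ℝ | τ ≤ (((Finset.range N).filter (fun i => x i ≤ t)).card : ℝ) / N}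

/-- `P` has density `f` with respect to Lebesgue measure on a neighbourhood of `x`, and `f` is
continuous at `x`. -/
structure HasContinuousDensityAt (P : Measure ℝ) (f : ℝ → ℝ) (x : ℝ) : Prop where
  continuousAt : ContinuousAt f x
  exists_density : ∃ ε : ℝ, 0 < ε ∧
    (∀ y ∈ Set.Ioo (x - ε) (x + ε), 0 ≤ f y) ∧
    AEMeasurable f (volume.restrict (Set.Ioo (x - ε) (x + ε))) ∧
    P.restrict (Set.Ioo (x - ε) (x + ε)) =
      (volume.restrict (Set.Ioo (x - ε) (x + ε))).withDensity (fun y => ENNReal.ofReal (f y))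

/-- The conditional distribution of the excess `C - t` given `C > t`, where `C` has law `P`. -/
def excessLaw (P : Measure ℝ) (t : ℝ) : Measure ℝ :=
  (P[|Set.Ioi t]).map (fun c => c - t)

/-- `X 0, X 1, …` is an i.i.d. sequence of random variables with law `P`. -/
structure IsIIDSample {Ω : Type*} [MeasurableSpace Ω] (X : ℕ → Ω → ℝ) (P : Measure ℝ)
    (Pr : Measure Ω) : Prop where
  indep : iIndepFun X Pr
  hasLaw : ∀ i, HasLaw (X i) P Pr

/-- The estimators `T N` of `θ` are asymptotically normal with asymptotic variance `V N`:
`(T N - θ) / √(V N)` converges in distribution to a standard Gaussian. -/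
def IsAsymptoticallyNormal {Ω : Type*} [MeasurableSpace Ω] (Pr : Measure Ω)
    [IsProbabilityMeasure Pr] (T : ℕ → Ω → ℝ) (θ : ℝ) (V : ℕ → ℝ) : Prop :=
  TendstoInDistribution (fun N ω => (T N ω - θ) / √(V N)) atTop
    (id : ℝ → ℝ) (fun _ => Pr) (gaussianReal 0 1)

end

/-!
Both asymptotic statements are instances of one theorem about a law `P` whose distribution function
`F` has a derivative `f > 0` at its `τ`-quantile `q`, `tendstoInDistribution_sampleQuantile`.
A continuous density near `q` provides that derivative
(`HasContinuousDensityAt.hasDerivAt_cdf`), and `F q = τ` (`cdf_quantile`).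

To prove it, compute the distribution function of the normalized error at `t`. The sample quantile
is the generalized inverse of the empirical distribution function `F_N`
(`sampleQuantile_le_iff`), so `√N (q̂ - q) ≤ t` says that `F_N (q + t / √N) ≥ τ`, that is,
`√N (F_N q - F q) + √N (F_N (q + t / √N) - F_N q) ≥ 0`.
The first term converges in distribution to `N(0, τ (1 - τ))` by the central limit theorem for
Bernoulli variables (`tendstoInDistribution_empirical`). The second has mean
`√N (F (q + t / √N) - F q) → f t` and a variance that tends to `0`, so it converges to `f t` in
probability by Chebyshev's inequality (`tendstoInMeasure_localIncrement`). By Slutsky's theorem the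
probability converges to that of `Z + f t ≥ 0` with `Z` of law `N(0, τ (1 - τ))`, which is the
distribution function at `t` of `N(0, τ (1 - τ) / f ^ 2)`; pointwise convergence of distribution
functions gives weak convergence (`tendsto_probabilityMeasure_of_tendsto_Iic`).

The comparison of the two estimators rests on the identity
`F_C (s + y) = F_C s + (1 - F_C s) F_H y` for `y ≥ 0`, where `H` is the law of the excess of `C`
over `s` (`cdf_add_of_excessLaw`). It transports quantiles by a shift and, after differentiation,
densities by a shift and the factor `1 - F_C s`. Once `f_C = (1 - μ) f_H` is known, both variances
have the same denominator and their order is `ν < μ + ν`.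
-/

/-! ### Distribution functions and quantiles -/

theorem HasContinuousDensityAt.hasDerivAt_cdf {P : Measure ℝ} [IsProbabilityMeasure P]
    {f : ℝ → ℝ} {x : ℝ} (h : HasContinuousDensityAt P f x) : HasDerivAt (cdf P) (f x) x := by
  obtain ⟨hc, ε, hε, hnn, hm, hP⟩ := h
  set I := Set.Ioo (x - ε) (x + ε) with hI
  have hint : IntegrableOn f I := by
    refine ⟨hm.aestronglyMeasurable, ?_⟩
    have h0 : 0 ≤ᵐ[volume.restrict I] f :=
      (ae_restrict_iff' measurableSet_Ioo).2 (Eventually.of_forall hnn)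
    rw [hasFiniteIntegral_iff_ofReal h0]
    have := congrArg (fun m : Measure ℝ => m Set.univ) hP
    simp only [withDensity_apply _ MeasurableSet.univ, Measure.restrict_univ] at this
    rw [← this]
    exact measure_lt_top _ _
  have hcdf : ∀ a ∈ I, ∀ y ∈ I, a ≤ y → cdf P y = cdf P a + ∫ u in a..y, f u := by
    intro a ha y hy hay
    have hsub : Set.Ioc a y ⊆ I := fun u hu => ⟨ha.1.trans hu.1, hu.2.trans_lt hy.2⟩
    have h1 : P (Set.Ioc a y) = ∫⁻ u in Set.Ioc a y, ENNReal.ofReal (f u) := by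
      rw [← Set.inter_eq_left.2 hsub, ← Measure.restrict_apply measurableSet_Ioc, hP,
        withDensity_apply _ measurableSet_Ioc, Measure.restrict_restrict measurableSet_Ioc]
    have h2 : P.real (Set.Ioc a y) = ∫ u in a..y, f u := by
      rw [intervalIntegral.integral_of_le hay, integral_eq_lintegral_of_nonneg_ae _
        (hint.mono_set hsub).aestronglyMeasurable, measureReal_def, h1]
      exact (ae_restrict_iff' measurableSet_Ioc).2
        (Eventually.of_forall fun u hu => hnn u (hsub hu))
    rw [← h2, cdf_eq_real, cdf_eq_real, ← Set.Iic_sdiff_Iic,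
      measureReal_sdiff (Set.Iic_subset_Iic.2 hay) measurableSet_Iic]
    ring
  -- any base point of the interval to the left of `x` would do
  set a := x - ε / 2 with ha
  have haI : a ∈ I := ⟨by linarith, by linarith⟩
  have hxI : x ∈ I := ⟨by linarith, by linarith⟩
  have hax : a < x := by linarith
  have hII : IntervalIntegrable f volume a x := by
    rw [intervalIntegrable_iff_integrableOn_Ioc_of_le hax.le]
    exact hint.mono_set fun u hu => ⟨haI.1.trans hu.1, hu.2.trans_lt hxI.2⟩
  have hd := intervalIntegral.integral_hasDerivAt_right hII
    ⟨I, Ioo_mem_nhds hxI.1 hxI.2, hint.aestronglyMeasurable⟩ hc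
  refine (hd.const_add (cdf P a)).congr_of_eventuallyEq ?_
  filter_upwards [Ioo_mem_nhds hax hxI.2] with y hy
  exact hcdf a haI y ⟨haI.1.trans hy.1, hy.2⟩ hy.1.le

/-- The Galois connection between a distribution function and its generalized inverse. -/
theorem sInf_setOf_le_le_iff {F : ℝ → ℝ} (hF : Monotone F)
    (hr : ∀ t, ContinuousWithinAt F (Set.Ioi t) t) {τ : ℝ}
    (hne : {x | τ ≤ F x}.Nonempty) (hb : BddBelow {x | τ ≤ F x}) (t : ℝ) :
    sInf {x | τ ≤ F x} ≤ t ↔ τ ≤ F t := by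
  refine ⟨fun h => ?_, fun h => csInf_le hb h⟩
  refine ge_of_tendsto (hr t) ?_
  filter_upwards [self_mem_nhdsWithin] with y hy
  obtain ⟨s, hs, hsy⟩ := exists_lt_of_csInf_lt hne (h.trans_lt hy)
  exact le_trans hs (hF hsy.le)

theorem quantile_le_iff (P : Measure ℝ) {τ : ℝ} (h0 : 0 < τ) (h1 : τ < 1) (t : ℝ) :
    quantile P τ ≤ t ↔ τ ≤ cdf P t := by
  refine sInf_setOf_le_le_iff (monotone_cdf P)
    (fun t => ((cdf P).right_continuous t).mono Set.Ioi_subset_Ici_self) ?_ ?_ t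
  · exact ((tendsto_cdf_atTop P).eventually_const_le h1).exists
  · obtain ⟨b, hb⟩ := ((tendsto_cdf_atBot P).eventually_lt_const h0).exists
    exact ⟨b, fun x hx => le_of_not_gt fun hxb =>
      (hb.trans_le hx).not_ge (monotone_cdf P hxb.le)⟩

theorem cdf_quantile {P : Measure ℝ} {τ : ℝ} (h0 : 0 < τ) (h1 : τ < 1)
    (hc : ContinuousAt (cdf P) (quantile P τ)) : cdf P (quantile P τ) = τ := by
  refine le_antisymm ?_ ((quantile_le_iff P h0 h1 _).1 le_rfl)
  have hl : Tendsto (cdf P) (𝓝[<] quantile P τ) (𝓝 (cdf P (quantile P τ))) :=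
    hc.tendsto.mono_left nhdsWithin_le_nhds
  refine le_of_tendsto hl ?_
  filter_upwards [self_mem_nhdsWithin] with y hy
  exact (not_le.1 fun h => (not_le.2 hy) ((quantile_le_iff P h0 h1 y).2 h)).le

/-- Pointwise convergence of the distribution functions implies weak convergence. -/
theorem tendsto_probabilityMeasure_of_tendsto_Iic {ι : Type*} {l : Filter ι}
    [l.IsCountablyGenerated] {m : ι → ProbabilityMeasure ℝ} {m' : ProbabilityMeasure ℝ}
    (h : ∀ t, Tendsto (fun i => (m i : Measure ℝ).real (Set.Iic t)) l
      (𝓝 ((m' : Measure ℝ).real (Set.Iic t)))) : Tendsto m l (𝓝 m') := by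
  refine (isPiSystem_Ioc (id : ℝ → ℝ) id).tendsto_probabilityMeasure_of_tendsto_of_mem ?_ ?_ ?_
  · rintro s ⟨a, b, -, rfl⟩
    exact measurableSet_Ioc
  · intro u hu x hx
    obtain ⟨ε, hε, hs⟩ := Metric.isOpen_iff.1 hu x hx
    refine ⟨Set.Ioc (x - ε / 2) (x + ε / 2), ⟨x - ε / 2, x + ε / 2, ?_, rfl⟩,
      Ioc_mem_nhds (by linarith) (by linarith), fun y hy => hs ?_⟩
    · simp only [id]; linarith
    · rw [Metric.mem_ball, Real.dist_eq, abs_lt]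
      constructor <;> linarith [hy.1, hy.2]
  · rintro s ⟨a, b, hab, rfl⟩
    have key : ∀ p : ProbabilityMeasure ℝ, (p (Set.Ioc a b) : ℝ) =
        (p : Measure ℝ).real (Set.Iic b) - (p : Measure ℝ).real (Set.Iic a) := fun p => by
      rw [← measureReal_sdiff (Set.Iic_subset_Iic.2 (show a ≤ b from hab.le)) measurableSet_Iic,
        Set.Iic_sdiff_Iic]
      rfl
    rw [← NNReal.tendsto_coe]
    simp only [id, key]
    exact (h b).sub (h a)

/-! ### The sample quantile -/

/-- The event that the sample quantile is at most `t`, in terms of the number of sample points that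
are at most `t`. The level has to be positive and `N` nonzero, as otherwise the infimum that defines
the sample quantile is over an unbounded or an empty set. -/
theorem sampleQuantile_le_iff {N : ℕ} (hN : N ≠ 0) {τ : ℝ} (h0 : 0 < τ) (h1 : τ < 1)
    (x : ℕ → ℝ) (t : ℝ) :
    sampleQuantile N x τ ≤ t ↔
      τ * N ≤ ∑ i ∈ Finset.range N, (Set.Iic t).indicator (fun _ => (1 : ℝ)) (x i) := by
  have hN' : (0 : ℝ) < N := by positivity
  set F : ℝ → ℝ := fun t => (((Finset.range N).filter (fun i => x i ≤ t)).card : ℝ) / N with hF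
  have hmono : Monotone F := fun s t hst => by
    simp only [hF]
    gcongr with i hi
  have hright : ∀ t, ContinuousWithinAt F (Set.Ioi t) t := by
    -- the empirical distribution function is locally constant to the right of every point
    intro t
    have hev : ∀ᶠ s in 𝓝[>] t, ∀ i ∈ Finset.range N, (x i ≤ s ↔ x i ≤ t) := by
      rw [Filter.eventually_all_finset]
      intro i _
      by_cases h : x i ≤ t
      · filter_upwards [self_mem_nhdsWithin] with s hs
        exact iff_of_true (h.trans (le_of_lt hs)) h
      · filter_upwards [mem_nhdsWithin_of_mem_nhds (Iio_mem_nhds (not_le.1 h))] with s hs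
        exact iff_of_false (not_le.2 hs) h
    refine tendsto_const_nhds.congr' ?_
    filter_upwards [hev] with s hs
    simp only [hF]
    rw [Finset.filter_congr hs]
  have hne : {t | τ ≤ F t}.Nonempty := by
    obtain ⟨M, hM⟩ := ((Finset.range N).image x).bddAbove
    refine ⟨M, ?_⟩
    have : (Finset.range N).filter (fun i => x i ≤ M) = Finset.range N :=
      Finset.filter_true_of_mem fun i hi => hM (Finset.mem_coe.2 (Finset.mem_image_of_mem _ hi))
    simp only [hF, Set.mem_ofPred_eq, this, Finset.card_range, div_self hN'.ne']
    exact h1.le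
  have hb : BddBelow {t | τ ≤ F t} := by
    obtain ⟨M, hM⟩ := ((Finset.range N).image x).bddBelow
    refine ⟨M, fun t ht => le_of_not_gt fun htM => ?_⟩
    have : (Finset.range N).filter (fun i => x i ≤ t) = ∅ :=
      Finset.filter_false_of_mem fun i hi => not_le.2
        (htM.trans_le (hM (Finset.mem_coe.2 (Finset.mem_image_of_mem _ hi))))
    simp only [hF, Set.mem_ofPred_eq, this, Finset.card_empty, Nat.cast_zero, zero_div] at ht
    linarith
  rw [show sampleQuantile N x τ = sInf {t | τ ≤ F t} from rfl,
    sInf_setOf_le_le_iff hmono hright hne hb, hF, le_div_iff₀ hN', Finset.card_filter]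
  simp [Set.indicator_apply]

theorem measurable_sampleQuantile (N : ℕ) {τ : ℝ} (h0 : 0 < τ) (h1 : τ < 1) :
    Measurable (fun x : ℕ → ℝ => sampleQuantile N x τ) := by
  rcases eq_or_ne N 0 with rfl | hN
  · simp [sampleQuantile]
  · refine measurable_of_Iic fun t => ?_
    have : (fun x : ℕ → ℝ => sampleQuantile N x τ) ⁻¹' Set.Iic t = {x | τ * N ≤
        ∑ i ∈ Finset.range N, (Set.Iic t).indicator (fun _ => (1 : ℝ)) (x i)} := by
      ext x
      exact sampleQuantile_le_iff hN h0 h1 x t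
    rw [this]
    refine measurableSet_le measurable_const (Finset.measurable_fun_sum _ fun i _ => ?_)
    exact (measurable_const.indicator measurableSet_Iic).comp (measurable_pi_apply i)

/-! ### Sums over i.i.d. samples -/

/-- Random variables whose means converge to `c` and whose variances tend to `0` converge to `c` in
probability, by Chebyshev's inequality. -/
theorem tendstoInMeasure_const_of_tendsto_variance {Ω : Type*} [MeasurableSpace Ω]
    {Pr : Measure Ω} [IsProbabilityMeasure Pr] {Y : ℕ → Ω → ℝ} {c : ℝ}
    (hY : ∀ n, MemLp (Y n) 2 Pr) (hmean : Tendsto (fun n => Pr[Y n]) atTop (𝓝 c))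
    (hvar : Tendsto (fun n => Var[Y n; Pr]) atTop (𝓝 0)) :
    TendstoInMeasure Pr Y atTop (fun _ => c) := by
  rw [tendstoInMeasure_iff_norm]
  intro ε hε
  have hlim : Tendsto (fun n => ENNReal.ofReal (Var[Y n; Pr] / (ε / 2) ^ 2)) atTop (𝓝 0) := by
    simpa using ENNReal.tendsto_ofReal (hvar.div_const ((ε / 2) ^ 2))
  refine tendsto_of_tendsto_of_tendsto_of_le_of_le' tendsto_const_nhds hlim
    (Eventually.of_forall fun _ => zero_le) ?_
  filter_upwards [Metric.tendsto_nhds.1 hmean (ε / 2) (half_pos hε)] with n hn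
  refine le_trans (measure_mono fun ω hω => ?_) (meas_ge_le_variance_div_sq (hY n) (half_pos hε))
  rw [Real.dist_eq] at hn
  simp only [Set.mem_ofPred_eq, Real.norm_eq_abs] at hω ⊢
  have := abs_sub_le (Y n ω) (Pr[Y n]) c
  linarith

section Law
variable {Ω : Type*} [MeasurableSpace Ω] {Pr : Measure Ω} {P : Measure ℝ}

theorem ProbabilityTheory.HasLaw.memLp_two_comp {Y : Ω → ℝ} (hY : HasLaw Y P Pr) {g : ℝ → ℝ}
    (hg : MemLp g 2 P) : MemLp (fun ω => g (Y ω)) 2 Pr := by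
  rw [← hY.map_eq] at hg
  exact (memLp_map_measure_iff hg.1 hY.aemeasurable).1 hg

theorem ProbabilityTheory.HasLaw.variance_fun_comp {Y : Ω → ℝ} (hY : HasLaw Y P Pr) {g : ℝ → ℝ}
    (hg : Measurable g) : Var[fun ω => g (Y ω); Pr] = Var[g; P] := by
  rw [← hY.map_eq, variance_map hg.aemeasurable hY.aemeasurable]
  rfl

theorem variance_sum_comp {X : ℕ → Ω → ℝ} (hX : IsIIDSample X P Pr) {g : ℝ → ℝ}
    (hg : Measurable g) (hg2 : MemLp g 2 P) (N : ℕ) :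
    Var[fun ω => ∑ i ∈ Finset.range N, g (X i ω); Pr] = N * Var[g; P] := by
  have := IndepFun.variance_sum (μ := Pr) (X := fun i ω => g (X i ω)) (s := Finset.range N)
    (fun i _ => (hX.hasLaw i).memLp_two_comp hg2)
    (fun i _ j _ hij => (hX.indep.indepFun hij).comp hg hg)
  rw [show (fun ω => ∑ i ∈ Finset.range N, g (X i ω)) =
    ∑ i ∈ Finset.range N, fun ω => g (X i ω) by ext; simp, this]
  simp [fun i => (hX.hasLaw i).variance_fun_comp hg]

theorem integral_sum_comp {X : ℕ → Ω → ℝ} (hX : IsIIDSample X P Pr) {g : ℝ → ℝ}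
    (hgi : Integrable g P) (N : ℕ) :
    ∫ ω, ∑ i ∈ Finset.range N, g (X i ω) ∂Pr = N * ∫ x, g x ∂P := by
  have h1 : ∀ i, Integrable (fun ω => g (X i ω)) Pr := fun i => by
    have := hgi
    rw [← (hX.hasLaw i).map_eq] at this
    exact this.comp_aemeasurable (hX.hasLaw i).aemeasurable
  have hv : ∀ i, ∫ ω, g (X i ω) ∂Pr = ∫ x, g x ∂P := fun i =>
    (hX.hasLaw i).integral_comp hgi.1
  rw [integral_finsetSum _ fun i _ => h1 i]
  simp [hv]

end Law

/-! ### Indicators of lower half-lines -/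

/-- The real-valued indicator function of `(-∞, t]`; its sum over a sample counts the sample points
that are at most `t`. -/
noncomputable def iicIndicator (t : ℝ) : ℝ → ℝ := (Set.Iic t).indicator fun _ => 1

theorem measurable_iicIndicator (t : ℝ) : Measurable (iicIndicator t) :=
  measurable_const.indicator measurableSet_Iic

theorem iicIndicator_mul (s t x : ℝ) :
    iicIndicator s x * iicIndicator t x = iicIndicator (min s t) x := by
  simp only [iicIndicator, Set.indicator_apply, Set.mem_Iic, le_min_iff, ite_and]
  split_ifs <;> simp

theorem memLp_iicIndicator (P : Measure ℝ) [IsProbabilityMeasure P] (t : ℝ) :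
    MemLp (iicIndicator t) 2 P :=
  (memLp_const 1).indicator measurableSet_Iic

theorem integrable_iicIndicator (P : Measure ℝ) [IsProbabilityMeasure P] (t : ℝ) :
    Integrable (iicIndicator t) P := (memLp_iicIndicator P t).integrable one_le_two

theorem integral_iicIndicator (P : Measure ℝ) [IsProbabilityMeasure P] (t : ℝ) :
    ∫ x, iicIndicator t x ∂P = cdf P t := by
  rw [cdf_eq_real, iicIndicator, integral_indicator measurableSet_Iic]
  simp

theorem integral_sq_iicIndicator_sub (P : Measure ℝ) [IsProbabilityMeasure P] (s t : ℝ) :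
    ∫ x, (iicIndicator s x - iicIndicator t x) ^ 2 ∂P =
      cdf P s + cdf P t - 2 * cdf P (min s t) := by
  have : ∀ x, (iicIndicator s x - iicIndicator t x) ^ 2 =
      iicIndicator s x + iicIndicator t x - 2 * iicIndicator (min s t) x := fun x => by
    have h1 := iicIndicator_mul s s x
    have h2 := iicIndicator_mul t t x
    have h3 := iicIndicator_mul s t x
    rw [min_self] at h1 h2
    linear_combination h1 + h2 - 2 * h3
  simp only [this]
  rw [integral_sub, integral_add, integral_const_mul, integral_iicIndicator,
    integral_iicIndicator, integral_iicIndicator]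
  all_goals first
    | exact integrable_iicIndicator P _
    | exact (integrable_iicIndicator P _).const_mul 2
    | exact (integrable_iicIndicator P _).add (integrable_iicIndicator P _)

theorem variance_iicIndicator (P : Measure ℝ) [IsProbabilityMeasure P] (t : ℝ) :
    Var[iicIndicator t; P] = cdf P t * (1 - cdf P t) := by
  rw [variance_eq_sub (memLp_iicIndicator P t), integral_iicIndicator]
  have : ∀ x, (iicIndicator t ^ 2) x = iicIndicator t x := fun x => by
    rw [Pi.pow_apply, sq, iicIndicator_mul, min_self]
  simp only [this, integral_iicIndicator]
  ring

/-! ### Asymptotic normality of sample quantiles -/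

section IID
variable {Ω : Type*} [MeasurableSpace Ω] {Pr : Measure Ω} [IsProbabilityMeasure Pr]
  {P : Measure ℝ} [IsProbabilityMeasure P] {X : ℕ → Ω → ℝ}

/-- The increment of the empirical process between `q` and `q + t / √N`: it is a sum of `N`
differences of indicators whose variances tend to `0`, scaled by `1 / √N`, so only its
mean survives. -/
theorem tendstoInMeasure_localIncrement (hX : IsIIDSample X P Pr) {q f : ℝ}
    (hd : HasDerivAt (cdf P) f q) (t : ℝ) :
    TendstoInMeasure Pr (fun (N : ℕ) ω => (√(N : ℝ))⁻¹ * ∑ i ∈ Finset.range N,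
      (iicIndicator (q + t / √(N : ℝ)) (X i ω) - iicIndicator q (X i ω))) atTop
      (fun _ => f * t) := by
  set qN : ℕ → ℝ := fun N => q + t / √(N : ℝ) with hqN
  set g : ℕ → ℝ → ℝ := fun N x => iicIndicator (qN N) x - iicIndicator q x with hg
  have hgm : ∀ N, Measurable (g N) := fun N =>
    (measurable_iicIndicator _).sub (measurable_iicIndicator _)
  have hg2 : ∀ N, MemLp (g N) 2 P := fun N =>
    (memLp_iicIndicator P _).sub (memLp_iicIndicator P _)
  have hsqrt : Tendsto (fun N : ℕ => √(N : ℝ)) atTop atTop :=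
    Real.tendsto_sqrt_atTop.comp tendsto_natCast_atTop_atTop
  have hq : Tendsto qN atTop (𝓝 q) := by
    simpa using (hsqrt.const_div_atTop t).const_add q
  have hcq : Tendsto (fun N => cdf P (qN N)) atTop (𝓝 (cdf P q)) :=
    hd.continuousAt.tendsto.comp hq
  have hi : ∀ N, MemLp (fun ω => ∑ i ∈ Finset.range N, g N (X i ω)) 2 Pr := fun N => by
    exact memLp_finsetSum _ fun i _ => (hX.hasLaw i).memLp_two_comp (hg2 N)
  refine tendstoInMeasure_const_of_tendsto_variance (fun N => (hi N).const_mul _) ?_ ?_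
  · have hmean : ∀ N : ℕ, ∫ ω, (√(N : ℝ))⁻¹ * ∑ i ∈ Finset.range N, g N (X i ω) ∂Pr =
        √(N : ℝ) * (cdf P (qN N) - cdf P q) := fun N => by
      rw [integral_const_mul, integral_sum_comp hX ((hg2 N).integrable one_le_two), hg,
        integral_sub (integrable_iicIndicator P _) (integrable_iicIndicator P _),
        integral_iicIndicator, integral_iicIndicator, ← mul_assoc]
      congr 1
      rw [inv_mul_eq_div, Real.div_sqrt]
    refine Tendsto.congr (fun N => (hmean N).symm) ?_
    have := (hd.hasFDerivAt.lim_real t).comp hsqrt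
    simp only [ContinuousLinearMap.toSpanSingleton_apply, smul_eq_mul] at this
    refine (this.congr fun N => ?_).trans_eq (by rw [mul_comm])
    simp only [Function.comp_apply, hqN, div_eq_inv_mul]
  · have hle : ∀ N : ℕ, Var[fun ω => (√(N : ℝ))⁻¹ * ∑ i ∈ Finset.range N, g N (X i ω); Pr] ≤
        cdf P (qN N) + cdf P q - 2 * cdf P (min (qN N) q) := fun N => by
      have h3 : Var[g N; P] ≤ cdf P (qN N) + cdf P q - 2 * cdf P (min (qN N) q) := by
        rw [← integral_sq_iicIndicator_sub]
        exact variance_le_expectation_sq (hg2 N).1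
      rw [variance_const_mul, variance_sum_comp hX (hgm N) (hg2 N), inv_pow,
        Real.sq_sqrt (Nat.cast_nonneg N), ← mul_assoc]
      refine le_trans ?_ h3
      exact mul_le_of_le_one_left (variance_nonneg _ _) (inv_mul_le_one)
    refine tendsto_of_tendsto_of_tendsto_of_le_of_le tendsto_const_nhds ?_
      (fun N => variance_nonneg _ _) hle
    have hmin : Tendsto (fun N => cdf P (min (qN N) q)) atTop (𝓝 (cdf P q)) := by
      refine hd.continuousAt.tendsto.comp ?_
      simpa using hq.min (tendsto_const_nhds (x := q))
    have := (hcq.add_const (cdf P q)).sub (hmin.const_mul 2)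
    rwa [show cdf P q + cdf P q - 2 * cdf P q = 0 by ring] at this

/-- The central limit theorem for the empirical distribution function at a point. -/
theorem tendstoInDistribution_empirical (hX : IsIIDSample X P Pr) (q : ℝ)
    {Ω' : Type*} [MeasurableSpace Ω'] {Pr' : Measure Ω'} [IsProbabilityMeasure Pr'] {Y : Ω' → ℝ}
    (hY : HasLaw Y (gaussianReal 0 (cdf P q * (1 - cdf P q)).toNNReal) Pr') :
    TendstoInDistribution (fun (N : ℕ) ω => (√(N : ℝ))⁻¹ *
      (∑ i ∈ Finset.range N, iicIndicator q (X i ω) - N * cdf P q)) atTop Y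
      (fun _ => Pr) Pr' := by
  have hm := measurable_iicIndicator q
  have hlaw : ∀ i, Pr.map (X i) = P := fun i => (hX.hasLaw i).map_eq
  have hae : ∀ i, AEMeasurable (X i) Pr := fun i => (hX.hasLaw i).aemeasurable
  have hvar : Var[fun ω => iicIndicator q (X 0 ω); Pr] = cdf P q * (1 - cdf P q) := by
    rw [← variance_iicIndicator, (hX.hasLaw 0).variance_fun_comp hm]
  have hint : ∫ ω, iicIndicator q (X 0 ω) ∂Pr = cdf P q := by
    rw [← integral_iicIndicator]
    exact (hX.hasLaw 0).integral_comp hm.aestronglyMeasurable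
  have h := tendstoInDistribution_inv_sqrt_mul_sum_sub (P := Pr) (P' := Pr') (Y := Y)
    (X := fun i ω => iicIndicator q (X i ω)) (by rwa [hvar])
    ((hX.hasLaw 0).memLp_two_comp (memLp_iicIndicator P q))
    (hX.indep.comp (fun _ => iicIndicator q) fun _ => hm)
    (fun i => (IdentDistrib.mk (hae i) (hae 0) (by rw [hlaw, hlaw])).comp hm)
  simpa only [hint] using h

/-- Asymptotic normality of the sample quantile when the distribution function has a positive
derivative at the quantile. -/
theorem tendstoInDistribution_sampleQuantile (hX : IsIIDSample X P Pr) {τ : ℝ} (h0 : 0 < τ)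
    (h1 : τ < 1) {f : ℝ} (hf : 0 < f) (hd : HasDerivAt (cdf P) f (quantile P τ)) :
    TendstoInDistribution
      (fun (N : ℕ) ω => √(N : ℝ) * (sampleQuantile N (fun i => X i ω) τ - quantile P τ))
      atTop (id : ℝ → ℝ) (fun _ => Pr) (gaussianReal 0 (τ * (1 - τ) / f ^ 2).toNNReal) := by
  set q := quantile P τ with hq
  have hτ : cdf P q = τ := cdf_quantile h0 h1 hd.continuousAt
  have hv : 0 < τ * (1 - τ) := mul_pos h0 (sub_pos.2 h1)
  set v := (τ * (1 - τ) / f ^ 2).toNNReal with hvdef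
  have hv0 : v ≠ 0 := (Real.toNNReal_pos.2 (by positivity)).ne'
  have hae : ∀ i, AEMeasurable (X i) Pr := fun i => (hX.hasLaw i).aemeasurable
  have hae2 : ∀ N : ℕ, AEMeasurable
      (fun ω => √(N : ℝ) * (sampleQuantile N (fun i => X i ω) τ - q)) Pr := fun N =>
    (((measurable_sampleQuantile N h0 h1).comp_aemeasurable
      (aemeasurable_pi_lambda _ hae)).sub_const q).const_mul _
  refine ⟨hae2, aemeasurable_id, tendsto_probabilityMeasure_of_tendsto_Iic fun t => ?_⟩
  have : NullSingletonClass (gaussianReal 0 v) := nullSingletonClass_gaussianReal hv0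
  -- The limit of the empirical process is realized as `x ↦ -f * x` under the target Gaussian law,
  -- so that the limit event is `{x | 0 ≤ -f * x + f * t} = Set.Iic t`.
  have hlaw : HasLaw (fun x : ℝ => -f * x) (gaussianReal 0 (cdf P q * (1 - cdf P q)).toNNReal)
      (gaussianReal 0 v) := by
    convert! gaussianReal_const_mul (HasLaw.id (μ := gaussianReal 0 v)) (-f) using 2
    · simp
    · rw [hτ]
      ext
      simp only [NNReal.coe_mul, NNReal.coe_mk, hvdef]
      rw [Real.coe_toNNReal _ hv.le, Real.coe_toNNReal _ (by positivity)]
      field_simp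
  have hW := (tendstoInDistribution_empirical hX q hlaw).add_of_tendstoInMeasure_const
    (tendstoInMeasure_localIncrement hX hd t) (fun N => by
      have := measurable_iicIndicator q
      have := measurable_iicIndicator (q + t / √(N : ℝ))
      fun_prop)
  have hport := ProbabilityMeasure.tendsto_measure_of_null_frontier_of_tendsto' hW.tendsto
    (E := Set.Ici 0) (by
      simp only [ProbabilityMeasure.coe_mk, frontier_Ici]
      rw [Measure.map_apply_of_aemeasurable hW.aemeasurable_limit (measurableSet_singleton 0)]
      refine measure_mono_null (t := {t}) (fun x hx => ?_) (measure_singleton t)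
      simp only [Set.mem_preimage, Set.mem_singleton_iff] at hx ⊢
      nlinarith [mul_left_cancel₀ hf.ne' (show f * x = f * t by linarith)])
  simp only [ProbabilityMeasure.coe_mk] at hport ⊢
  rw [Measure.map_apply_of_aemeasurable hW.aemeasurable_limit measurableSet_Ici] at hport
  have hset : (fun x : ℝ => -f * x + f * t) ⁻¹' Set.Ici 0 = Set.Iic t := by
    ext x
    simp only [Set.mem_preimage, Set.mem_Ici, Set.mem_Iic]
    rw [show -f * x + f * t = f * (t - x) by ring, mul_nonneg_iff_of_pos_left hf, sub_nonneg]
  rw [hset] at hport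
  simp only [measureReal_def, Measure.map_id]
  refine (ENNReal.tendsto_toReal (measure_ne_top _ _)).comp (hport.congr' ?_)
  filter_upwards [eventually_ne_atTop 0] with N hN
  have hsN : 0 < √(N : ℝ) := Real.sqrt_pos.2 (by positivity)
  rw [Measure.map_apply_of_aemeasurable (hW.forall_aemeasurable N) measurableSet_Ici,
    Measure.map_apply_of_aemeasurable (hae2 N) measurableSet_Iic]
  congr 1
  ext ω
  simp only [Set.mem_preimage, Set.mem_Ici, Set.mem_Iic, Pi.add_apply]
  rw [← le_div_iff₀' hsN, sub_le_iff_le_add', sampleQuantile_le_iff hN h0 h1, hτ, ← mul_add,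
    mul_nonneg_iff_of_pos_left (inv_pos.2 hsN), Finset.sum_sub_distrib]
  simp only [iicIndicator]
  constructor <;> intro h <;> linarith

end IID

/-- At `N = 0` both normalizations vanish: `√0 = 0`, and `v / 0 = 0` makes the quotient zero. -/
theorem isAsymptoticallyNormal_of_tendstoInDistribution {Ω : Type*} [MeasurableSpace Ω]
    {Pr : Measure Ω} [IsProbabilityMeasure Pr] {T : ℕ → Ω → ℝ} {θ v : ℝ} {V : ℕ → ℝ} (hv : 0 < v)
    (hV : ∀ N : ℕ, V N = v / N)
    (h : TendstoInDistribution (fun (N : ℕ) ω => √(N : ℝ) * (T N ω - θ)) atTop (id : ℝ → ℝ)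
      (fun _ => Pr) (gaussianReal 0 v.toNNReal)) : IsAsymptoticallyNormal Pr T θ V := by
  have hg : Continuous fun x : ℝ => x / √v := by fun_prop
  have hc := h.continuous_comp hg
  have hlaw : (gaussianReal 0 v.toNNReal).map ((fun x : ℝ => x / √v) ∘ id) =
      (gaussianReal 0 1).map id := by
    rw [Function.comp_id, gaussianReal_map_div_const, Measure.map_id, zero_div]
    congr 1
    ext
    rw [NNReal.coe_div, NNReal.coe_mk, Real.sq_sqrt hv.le, Real.coe_toNNReal _ hv.le,
      div_self hv.ne', NNReal.coe_one]
  have hfun : (fun N ω => (T N ω - θ) / √(V N)) =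
      fun N : ℕ => (fun x : ℝ => x / √v) ∘ fun ω => √(N : ℝ) * (T N ω - θ) := by
    funext N ω
    simp only [Function.comp_apply, hV, Real.sqrt_div hv.le]
    rw [div_div_eq_mul_div, mul_comm]
  rw [IsAsymptoticallyNormal, hfun]
  refine ⟨hc.forall_aemeasurable, aemeasurable_id, ?_⟩
  convert! hc.tendsto using 2
  exact congrArg 𝓝 (Subtype.ext hlaw.symm)

theorem isAsymptoticallyNormal_sampleQuantile {Ω : Type*} [MeasurableSpace Ω]
    {Pr : Measure Ω} [IsProbabilityMeasure Pr] {P : Measure ℝ} [IsProbabilityMeasure P]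
    {X : ℕ → Ω → ℝ} (hX : IsIIDSample X P Pr) {τ : ℝ} (h0 : 0 < τ)
    (h1 : τ < 1) {f v : ℝ} (hf : 0 < f) (hd : HasDerivAt (cdf P) f (quantile P τ))
    (hv : v = τ * (1 - τ) / f ^ 2) {V : ℕ → ℝ} (hV : ∀ N : ℕ, V N = v / N) :
    TendstoInDistribution
      (fun (N : ℕ) ω => √(N : ℝ) * (sampleQuantile N (fun i => X i ω) τ - quantile P τ))
      atTop (id : ℝ → ℝ) (fun _ => Pr) (gaussianReal 0 v.toNNReal) ∧
    IsAsymptoticallyNormal Pr (fun N ω => sampleQuantile N (fun i => X i ω) τ)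
      (quantile P τ) V := by
  have hpos : 0 < v := hv ▸ div_pos (mul_pos h0 (sub_pos.2 h1)) (pow_pos hf 2)
  have h := tendstoInDistribution_sampleQuantile hX h0 h1 hf hd
  rw [← hv] at h
  exact ⟨h, isAsymptoticallyNormal_of_tendstoInDistribution hpos hV h⟩

/-! ### Excesses over a threshold -/

section Excess
variable {P : Measure ℝ} {s : ℝ}

theorem cdf_excessLaw_of_nonpos [IsProbabilityMeasure (excessLaw P s)] {y : ℝ} (hy : y ≤ 0) :
    cdf (excessLaw P s) y = 0 := by
  rw [cdf_eq_real, measureReal_def, excessLaw, Measure.map_apply (by fun_prop) measurableSet_Iic,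
    cond_apply measurableSet_Ioi]
  have : Set.Ioi s ∩ (fun c => c - s) ⁻¹' Set.Iic y = ∅ := by
    ext c
    simp only [Set.mem_inter_iff, Set.mem_Ioi, Set.mem_preimage, Set.mem_Iic,
      Set.mem_empty_iff_false, iff_false, not_and, not_le]
    intro h
    linarith
  rw [this, measure_empty, mul_zero, ENNReal.toReal_zero]

variable [IsProbabilityMeasure P]

/-- The distribution function of a law above a threshold `s`, recovered from that of its excess
over `s`. -/
theorem cdf_add_of_excessLaw [IsProbabilityMeasure (excessLaw P s)] (hs : cdf P s < 1) {y : ℝ}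
    (hy : 0 ≤ y) :
    cdf P (s + y) = cdf P s + (1 - cdf P s) * cdf (excessLaw P s) y := by
  have hIoi : P.real (Set.Ioi s) = 1 - cdf P s := by
    rw [cdf_eq_real, ← Set.compl_Iic, probReal_compl_eq_one_sub measurableSet_Iic]
  have hset : Set.Ioi s ∩ (fun c => c - s) ⁻¹' Set.Iic y = Set.Ioc s (s + y) := by
    ext c
    simp only [Set.mem_inter_iff, Set.mem_Ioi, Set.mem_preimage, Set.mem_Iic, Set.mem_Ioc,
      sub_le_iff_le_add']
  rw [cdf_eq_real (excessLaw P s), excessLaw, map_measureReal_apply (by fun_prop) measurableSet_Iic,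
    measureReal_def, cond_apply measurableSet_Ioi, hset, ENNReal.toReal_mul, ENNReal.toReal_inv,
    ← measureReal_def, ← measureReal_def, hIoi, mul_inv_cancel_left₀ (sub_pos.2 hs).ne',
    cdf_eq_real, cdf_eq_real, ← Set.Iic_sdiff_Iic,
    measureReal_sdiff (Set.Iic_subset_Iic.2 (by linarith)) measurableSet_Iic]
  ring

theorem quantile_eq_add_quantile_excessLaw [IsProbabilityMeasure (excessLaw P s)] {ν : ℝ}
    (hν : 0 < ν) (h1 : cdf P s + ν < 1) :
    quantile P (cdf P s + ν) = s + quantile (excessLaw P s) (ν / (1 - cdf P s)) := by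
  have h0 : 0 ≤ cdf P s := cdf_nonneg P s
  have hs : 0 < 1 - cdf P s := by linarith
  have hτ0 : 0 < ν / (1 - cdf P s) := div_pos hν hs
  have hτ1 : ν / (1 - cdf P s) < 1 := by rw [div_lt_one hs]; linarith
  refine eq_of_forall_ge_iff fun t => ?_
  rw [quantile_le_iff P (by linarith) h1, ← le_sub_iff_add_le' (a := s), quantile_le_iff _ hτ0 hτ1]
  rcases le_total t s with h | h
  · -- both conditions fail to the left of the threshold
    rw [cdf_excessLaw_of_nonpos (sub_nonpos.2 h)]
    exact iff_of_false (by linarith [monotone_cdf P h]) (not_le.2 hτ0)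
  · have := cdf_add_of_excessLaw (P := P) (s := s) (by linarith) (sub_nonneg.2 h)
    rw [add_sub_cancel] at this
    rw [this, div_le_iff₀' hs, add_le_add_iff_left]

/-- The densities are the derivatives of the two distribution functions, which
`cdf_add_of_excessLaw` relates near `z`. -/
theorem density_add_of_excessLaw [IsProbabilityMeasure (excessLaw P s)] (hs : cdf P s < 1)
    {fH fC : ℝ → ℝ} {z : ℝ} (hz : 0 < z) (hH : HasContinuousDensityAt (excessLaw P s) fH z)
    (hC : HasContinuousDensityAt P fC (s + z)) : fC (s + z) = (1 - cdf P s) * fH z := by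
  refine (hC.hasDerivAt_cdf.comp_const_add s z).unique ?_
  refine ((hH.hasDerivAt_cdf.const_mul (1 - cdf P s)).const_add (cdf P s)).congr_of_eventuallyEq ?_
  filter_upwards [lt_mem_nhds hz] with y hy
  exact cdf_add_of_excessLaw hs hy.le

end Excess

/-! ### Variance of the estimators -/

theorem theorem3
    (μ ν : ℝ) (hμ : 0 < μ) (hν : 0 < ν) (hμν : μ + ν < 1)
    (H : Measure ℝ) [IsProbabilityMeasure H] (fH : ℝ → ℝ)
    (hcont : Continuous (fun x => cdf H x))
    (hdens : HasContinuousDensityAt H fH (quantile H (ν / (1 - μ))))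
    (hpos : 0 < fH (quantile H (ν / (1 - μ)))) :
    -- asymptotic normality of the estimator of the quantile of level `ν / (1 - μ)` of `H`
    (∀ {Ω : Type*} [MeasurableSpace Ω] (Pr : Measure Ω) [IsProbabilityMeasure Pr]
      (X : ℕ → Ω → ℝ), IsIIDSample X H Pr →
      TendstoInDistribution
        (fun (N : ℕ) ω =>
          √(N : ℝ) * (sampleQuantile N (fun i => X i ω) (ν / (1 - μ)) - quantile H (ν / (1 - μ))))
        atTop (id : ℝ → ℝ) (fun _ => Pr)
        (gaussianReal 0 (Real.toNNReal
          (ν * (1 - μ - ν) / ((1 - μ) ^ 2 * fH (quantile H (ν / (1 - μ))) ^ 2)))) ∧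
      IsAsymptoticallyNormal Pr
        (fun N ω => sampleQuantile N (fun i => X i ω) (ν / (1 - μ)))
        (quantile H (ν / (1 - μ)))
        (fun N => ν * (1 - μ - ν) / (N * (1 - μ) ^ 2 * fH (quantile H (ν / (1 - μ))) ^ 2))) ∧
    -- comparison with the direct estimation of the quantile of level `μ + ν` of the cost `C`
    (∀ (PC : Measure ℝ) [IsProbabilityMeasure PC] (fC : ℝ → ℝ),
      cdf PC (quantile PC μ) = μ →
      excessLaw PC (quantile PC μ) = H →
      HasContinuousDensityAt PC fC (quantile PC (μ + ν)) →
      quantile PC (μ + ν) = quantile PC μ + quantile H (ν / (1 - μ)) ∧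
      (∀ z : ℝ, 0 < z → HasContinuousDensityAt H fH z →
        HasContinuousDensityAt PC fC (quantile PC μ + z) →
        fC (quantile PC μ + z) = (1 - μ) * fH z) ∧
      fC (quantile PC (μ + ν)) = (1 - μ) * fH (quantile H (ν / (1 - μ))) ∧
      (∀ {Ω : Type*} [MeasurableSpace Ω] (Pr : Measure Ω) [IsProbabilityMeasure Pr]
        (C : ℕ → Ω → ℝ), IsIIDSample C PC Pr →
        TendstoInDistribution
          (fun (N : ℕ) ω =>
            √(N : ℝ) * (sampleQuantile N (fun i => C i ω) (μ + ν) - quantile PC (μ + ν)))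
          atTop (id : ℝ → ℝ) (fun _ => Pr)
          (gaussianReal 0 (Real.toNNReal
            ((μ + ν) * (1 - μ - ν) / fC (quantile PC (μ + ν)) ^ 2))) ∧
        IsAsymptoticallyNormal Pr
          (fun N ω => sampleQuantile N (fun i => C i ω) (μ + ν))
          (quantile PC (μ + ν))
          (fun N => (μ + ν) * (1 - μ - ν) / (N * fC (quantile PC (μ + ν)) ^ 2))) ∧
      (∀ N : ℕ, 1 ≤ N →
        ν * (1 - μ - ν) / (N * (1 - μ) ^ 2 * fH (quantile H (ν / (1 - μ))) ^ 2) <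
          (μ + ν) * (1 - μ - ν) / (N * fC (quantile PC (μ + ν)) ^ 2))) := by
  have hμ1 : 0 < 1 - μ := by linarith
  have hτ0 : 0 < ν / (1 - μ) := div_pos hν hμ1
  have hτ1 : ν / (1 - μ) < 1 := by rw [div_lt_one hμ1]; linarith
  refine ⟨fun Pr _ X hX => ?_, fun PC _ fC hμC hH hdC => ?_⟩
  · refine isAsymptoticallyNormal_sampleQuantile hX hτ0 hτ1 hpos hdens.hasDerivAt_cdf ?_ ?_
    · field_simp
    · intro N
      rw [div_div]
      ring_nf
  · subst hH
    have hq : quantile PC (μ + ν) =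
        quantile PC μ + quantile (excessLaw PC (quantile PC μ)) (ν / (1 - μ)) := by
      have := quantile_eq_add_quantile_excessLaw (P := PC) (s := quantile PC μ) hν
        (by rwa [hμC])
      rwa [hμC] at this
    have hz : 0 < quantile (excessLaw PC (quantile PC μ)) (ν / (1 - μ)) := by
      refine not_le.1 fun h => ?_
      rw [quantile_le_iff _ hτ0 hτ1, cdf_excessLaw_of_nonpos le_rfl] at h
      exact absurd hτ0 (not_lt.2 h)
    have hrel : ∀ z : ℝ, 0 < z →
        HasContinuousDensityAt (excessLaw PC (quantile PC μ)) fH z →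
        HasContinuousDensityAt PC fC (quantile PC μ + z) →
        fC (quantile PC μ + z) = (1 - μ) * fH z := fun z hz h1 h2 => by
      have := density_add_of_excessLaw (by rw [hμC]; linarith) hz h1 h2
      rwa [hμC] at this
    have hfC := hrel _ hz hdens (hq ▸ hdC)
    rw [← hq] at hfC
    have hfCpos : 0 < fC (quantile PC (μ + ν)) := hfC ▸ mul_pos hμ1 hpos
    refine ⟨hq, hrel, hfC, fun Pr _ C hC => ?_, fun N hN => ?_⟩
    · refine isAsymptoticallyNormal_sampleQuantile hC (by linarith) hμν hfCpos
        hdC.hasDerivAt_cdf (by ring) fun N => ?_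
      rw [div_div]
      ring_nf
    · have hN0 : (0 : ℝ) < N := by exact_mod_cast hN
      rw [hfC, mul_pow, ← mul_assoc]
      refine div_lt_div_of_pos_right ?_ (by positivity)
      exact mul_lt_mul_of_pos_right (by linarith) (by linarith)
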